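/- For positive integers $s_1,\dots,s_d$ and signs $\varepsilon_1,\dots,\varepsilon_d\in\{1,-1\}$ with $(s_1,\varepsilon_1)\neq(1,1)$, let $$\zeta(s_1,\dots,s_d;\varepsilon_1,\dots,\varepsilon_d)=\sum_{n_1>\cdots>n_d\ge 1}\frac{\varepsilon_1^{n_1}\cdots\varepsilon_d^{n_d}}{n_1^{s_1}\cdots n_d^{s_d}},$$ understood as the limit for $N\to\infty$ of the finite sums over $N\ge n_1>\cdots>n_d\ge 1$, and write $\zeta(s)=\zeta(s;1)$ and $\zeta(\overline{s})=\zeta(s;-1)=\sum_{m\ge1}(-1)^m/m^s$. These limits exist whenever all $s_i$ are positive even integers. For positive integers $d\le n$ let $$A_1(2n,d)=\sum\zeta(2j_1,\dots,2j_d;\varepsilon_1,\dots,\varepsilon_d),$$ where the sum is over all positive integers $j_1,\dots,j_d$ with $j_1+\cdots+j_d=n$ and all $\varepsilon\in\{1,-1\}^d$ with exactly one index $\ell$ such that $\varepsilon_\ell=-1$. **Theorem.** For all positive integers $d\le n$, $$A_1(2n,d)=\zeta(\overline{2n})-\sum_{j=0}^{\lfloor (d-2)/2\rfloor}\ \sum_{k=0}^{2j+1}\frac{(-1)^{d+j+k}}{(2j+1)!}\binom{2j+1}{k}\binom{(k-3)/2}{d-1}\,\zeta(2n-2j)\,\pi^{2j},$$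 where $\binom{x}{m}=x(x-1)\cdots(x-m+1)/m!$ for real $x$, and the sum over $j$ is empty for $d=1$. -/

import Mathlib

open Filter Topology

/-- The truncation of the Euler sum `ζ(s₁,…,s_d; ε₁,…,ε_d)` at `N`:
the sum of `∏ i, ε i ^ m i / m i ^ s i` over all `N ≥ m₁ > ⋯ > m_d ≥ 1`.
The sign `ε i ∈ {1, -1}` is a unit of `ℤ`. -/
noncomputable def eulerPartialSum {d : ℕ} (s : Fin d → ℕ) (ε : Fin d → ℤˣ) (N : ℕ) : ℝ :=
  ∑ m ∈ (Fintype.piFinset fun _ : Fin d => Finset.Icc 1 N).filter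
      (fun m => ∀ i j : Fin d, i < j → m j < m i),
    ∏ i : Fin d, ((ε i : ℤ) : ℝ) ^ m i / (m i : ℝ) ^ s i

/-- The (alternating) Euler sum `ζ(s₁,…,s_d; ε₁,…,ε_d)`, the limit of its truncations in the
outermost summation variable; the limit also exists in the conditionally convergent case
`s₁ = 1`, `ε₁ = -1`. -/
noncomputable def eulerSum {d : ℕ} (s : Fin d → ℕ) (ε : Fin d → ℤˣ) : ℝ :=
  limUnder atTop (eulerPartialSum s ε)

/-- The value `ζ(s)`, the depth one Euler sum without sign. -/
noncomputable def zetaValue (s : ℕ) : ℝ :=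
  eulerSum (fun _ : Fin 1 => s) (fun _ => 1)

/-- The value `ζ(s̄) = ∑ (-1)^m / m^s`, the depth one Euler sum with sign `-1`. -/
noncomputable def altZetaValue (s : ℕ) : ℝ :=
  eulerSum (fun _ : Fin 1 => s) (fun _ => -1)

/-- The restricted sum `A_α(2n, d)`: the sum of `ζ(2j₁,…,2j_d; ε₁,…,ε_d)` over all
`j₁ + ⋯ + j_d = n` with every `j_i > 0` and all sign vectors `ε` with exactly `α` entries `-1`. -/
noncomputable def restrictedSum (α n d : ℕ) : ℝ :=
  ∑ j ∈ (Finset.piAntidiag (Finset.univ : Finset (Fin d)) n).filter (fun j => ∀ i, 0 < j i),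
    ∑ ε ∈ (Finset.univ : Finset (Fin d → ℤˣ)).filter
        (fun ε => (Finset.univ.filter fun i => ε i = -1).card = α),
      eulerSum (fun i => 2 * j i) ε

/-!
Let `x = t²` and let `y` mark the depth. Over the index `m`, the geometric series
`∑_{j ≥ 1} x ^ j / m ^ (2 * j)` is `x / (m² - x)`, so the generating function of the restricted sums
`A₁(2n, d)` is `∏_m (1 + y x / (m² - x))` times `∑_m (-1) ^ m y x / (m² - (1 - y) x)`. With
`s = √(1 - y)`, the sine product and the partial fractions of `π t / sin (π t)` turn it into
`y / (2 s²) * (sin (π s t) / (s sin (π t)) - π t / sin (π t))`. The second term contributes the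
value `ζ` with sign `-1`. For the first term write
`sin (π s t) / sin (π t) = cos (π r t) - cot (π t) sin (π r t)` with `r = 1 - s`. As `r` is
divisible by `y`, the cosine does not contribute to `y ^ d` for `d ≤ n`, and only finitely many
terms of `sin (π r t)` do. Their coefficients come from the binomial series of
`(1 - y) ^ ((k - 3) / 2)`.

All of this is done with formal power series in `x` over `ℝ⟦y⟧`. The product formula is first proved
for truncations at `N` with denominators cleared (`one_sub_mul_restrictedPartialSeries`), and then
passed to the limit coefficientwise (`one_sub_mul_restrictedSeries`). The values of the depth one
sums come from the Fourier series of the Bernoulli polynomials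
(`one_sub_depthOneSeries_mul_sincSeries`). Together with the logarithmic derivative of the truncated
products, they also give the coefficients of the sine product (`tendsto_coeff_sincPartial`).
The identity for the limit is `restrictedSeries_closed_form`.
-/

/-! ### Convergence of the truncations -/

/-- The box sums of `∏ i, 1 / m i ^ 2` are powers of partial sums of `∑ 1 / m ^ 2`, so this product
is summable over all index vectors. -/
theorem summable_prod_inv_sq (d : ℕ) :
    Summable fun m : Fin d → ℕ => ∏ i, ((m i : ℝ) ^ 2)⁻¹ := by
  have hs : Summable fun m : ℕ => ((m : ℝ) ^ 2)⁻¹ := Real.summable_nat_pow_inv.2 (by norm_num)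
  refine summable_of_sum_le (c := (∑' m : ℕ, ((m : ℝ) ^ 2)⁻¹) ^ d)
    (fun m => Finset.prod_nonneg fun i _ => by positivity) fun u => ?_
  calc ∑ m ∈ u, ∏ i, ((m i : ℝ) ^ 2)⁻¹
      ≤ ∑ m ∈ Fintype.piFinset fun i => u.image fun m : Fin d → ℕ => m i,
          ∏ i, ((m i : ℝ) ^ 2)⁻¹ := by
        refine Finset.sum_le_sum_of_subset_of_nonneg (fun m hm => ?_)
          fun m _ _ => Finset.prod_nonneg fun i _ => by positivity
        exact Fintype.mem_piFinset.2 fun i => Finset.mem_image_of_mem (fun m : Fin d → ℕ => m i) hm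
    _ = ∏ i : Fin d, ∑ m ∈ u.image fun m : Fin d → ℕ => m i, ((m : ℝ) ^ 2)⁻¹ :=
        (Finset.prod_univ_sum (fun i => u.image fun m : Fin d → ℕ => m i)
          fun _ (m : ℕ) => ((m : ℝ) ^ 2)⁻¹).symm
    _ ≤ ∏ _i : Fin d, ∑' m : ℕ, ((m : ℝ) ^ 2)⁻¹ :=
        Finset.prod_le_prod (fun i _ => Finset.sum_nonneg fun m _ => by positivity)
          fun i _ => hs.sum_le_tsum _ fun m _ => by positivity
    _ = _ := by simp

/-- The truncations of an Euler sum with all arguments at least `2` converge: they are the partial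
sums, over boxes, of an absolutely summable family. -/
theorem tendsto_eulerPartialSum {d : ℕ} (s : Fin d → ℕ) (ε : Fin d → ℤˣ) (hs : ∀ i, 2 ≤ s i) :
    Tendsto (eulerPartialSum s ε) atTop (𝓝 (eulerSum s ε)) := by
  set f : (Fin d → ℕ) → ℝ := fun m =>
    if ∀ i j : Fin d, i < j → m j < m i then
      ∏ i : Fin d, ((ε i : ℤ) : ℝ) ^ m i / (m i : ℝ) ^ s i else 0 with hf
  have hsum : Summable f := by
    refine Summable.of_norm_bounded (summable_prod_inv_sq d) fun m => ?_
    have hnn : 0 ≤ ∏ i, ((m i : ℝ) ^ 2)⁻¹ := Finset.prod_nonneg fun i _ => by positivity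
    simp only [hf]
    split_ifs
    · rw [norm_prod]
      refine Finset.prod_le_prod (fun i _ => norm_nonneg _) fun i _ => ?_
      have hε : |((ε i : ℤ) : ℝ)| = 1 := by
        rcases Int.units_eq_one_or (ε i) with h | h <;> simp [h]
      rw [Real.norm_eq_abs, abs_div, abs_pow, hε, one_pow, one_div, abs_pow, Nat.abs_cast]
      rcases Nat.eq_zero_or_pos (m i) with h | h
      · have := hs i
        simp [h, show s i ≠ 0 by lia]
      · have h1 : (1 : ℝ) ≤ m i := by exact_mod_cast h
        exact inv_anti₀ (by positivity) (pow_le_pow_right₀ h1 (hs i))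
    · simpa using hnn
  have hbox : Tendsto (fun N : ℕ => Fintype.piFinset fun _ : Fin d => Finset.range (N + 1))
      atTop atTop := by
    refine tendsto_atTop_finset_of_monotone (fun a b hab => ?_) fun m => ⟨∑ i, m i, ?_⟩
    · exact Fintype.piFinset_subset _ _ fun _ => Finset.range_mono (by lia)
    · refine Fintype.mem_piFinset.2 fun i => ?_
      have := Finset.single_le_sum (f := m) (fun _ _ => Nat.zero_le _) (Finset.mem_univ i)
      simp; lia
  have heq : eulerPartialSum s ε =
      fun N => ∑ m ∈ Fintype.piFinset fun _ : Fin d => Finset.range (N + 1), f m := by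
    funext N
    rw [eulerPartialSum, Finset.sum_filter]
    refine Finset.sum_subset (Fintype.piFinset_subset _ _ fun _ m hm => ?_) fun m hm hm' => ?_
    · simp only [Finset.mem_Icc, Finset.mem_range] at *; lia
    -- A vector in the larger box only has an entry `0`, and its term is then `1 / 0 ^ s i = 0`.
    · obtain ⟨i, hi⟩ : ∃ i, m i = 0 := by
        by_contra! h
        refine hm' (Fintype.mem_piFinset.2 fun i => ?_)
        have h1 := Fintype.mem_piFinset.1 hm i
        have h2 := h i
        simp only [Finset.mem_Icc, Finset.mem_range] at *; lia
      have hz : ∏ i : Fin d, ((ε i : ℤ) : ℝ) ^ m i / (m i : ℝ) ^ s i = 0 := by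
        refine Finset.prod_eq_zero (Finset.mem_univ i) ?_
        have := hs i
        simp [hi, show s i ≠ 0 by lia]
      simp [hz]
  have hlim : Tendsto (eulerPartialSum s ε) atTop (𝓝 (∑' m, f m)) := by
    rw [heq]
    exact hsum.hasSum.comp hbox
  exact tendsto_nhds_limUnder ⟨_, hlim⟩

theorem eulerPartialSum_one (s : ℕ) (ε : ℤˣ) (N : ℕ) :
    eulerPartialSum (fun _ : Fin 1 => s) (fun _ => ε) N =
      ∑ m ∈ Finset.Icc 1 N, ((ε : ℤ) : ℝ) ^ m / (m : ℝ) ^ s := by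
  rw [eulerPartialSum, Finset.filter_true_of_mem
    fun m _ i j hij => absurd hij (by simp [Subsingleton.elim i j])]
  simpa using (Finset.prod_univ_sum (fun _ : Fin 1 => Finset.Icc 1 N)
    fun _ m => ((ε : ℤ) : ℝ) ^ m / (m : ℝ) ^ s).symm

open PowerSeries

/-! ### The restricted sum of the truncations as a sum over finite sets -/

/-- The geometric series `x / (m² - x) = ∑_{j ≥ 1} x ^ j / m ^ (2 * j)`. -/
noncomputable def geomSeries (m : ℕ) : ℝ⟦X⟧ :=
  PowerSeries.mk fun j => if j = 0 then 0 else ((m : ℝ) ^ (2 * j))⁻¹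

theorem sum_prod_inv_pow_eq_coeff {d : ℕ} (m : Fin d → ℕ) (n : ℕ) :
    ∑ j ∈ (Finset.piAntidiag (Finset.univ : Finset (Fin d)) n).filter (fun j => ∀ i, 0 < j i),
      ∏ i, ((m i : ℝ) ^ (2 * j i))⁻¹ = coeff n (∏ i, geomSeries (m i)) := by
  rw [coeff_prod]
  have h : ∑ l ∈ Finset.finsuppAntidiag (Finset.univ : Finset (Fin d)) n,
      ∏ i, coeff (l i) (geomSeries (m i)) =
      ∑ j ∈ Finset.piAntidiag (Finset.univ : Finset (Fin d)) n,
        ∏ i, coeff (j i) (geomSeries (m i)) := by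
    refine Finset.sum_bij' (fun l _ => ⇑l) (fun j _ => Finsupp.equivFunOnFinite.symm j)
      ?_ ?_ ?_ ?_ ?_
    · intro l hl
      simpa using (Finset.mem_finsuppAntidiag.1 hl).1
    · intro j hj
      simpa using (Finset.mem_piAntidiag.1 hj).1
    · intro l _
      simp
    · intro j _
      simp
    · intro l _
      rfl
  rw [h, Finset.sum_filter]
  refine Finset.sum_congr rfl fun j _ => ?_
  split_ifs with hj
  · refine Finset.prod_congr rfl fun i _ => ?_
    simp [geomSeries, (hj i).ne']
  · push Not at hj
    obtain ⟨i, hi⟩ := hj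
    exact (Finset.prod_eq_zero (Finset.mem_univ i) (by simp [geomSeries, Nat.le_zero.1 hi])).symm

theorem sum_prod_sign_pow_eq {d : ℕ} (m : Fin d → ℕ) :
    ∑ ε ∈ (Finset.univ : Finset (Fin d → ℤˣ)).filter
        (fun ε => (Finset.univ.filter fun i => ε i = -1).card = 1),
      ∏ i, ((ε i : ℤ) : ℝ) ^ m i = ∑ l, (-1 : ℝ) ^ m l := by
  symm
  have hne : (1 : ℤˣ) ≠ -1 := by decide
  refine Finset.sum_bij (fun l _ => Pi.mulSingle l (-1)) ?_ ?_ ?_ ?_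
  · intro l _
    simp only [Finset.mem_filter, Finset.mem_univ, true_and, Finset.card_eq_one]
    refine ⟨l, ?_⟩
    ext i
    by_cases h : i = l
    · subst h; simp
    · simp [h, hne]
  · intro a _ b _ hab
    by_contra h
    have := congrFun hab a
    simp [Pi.mulSingle_eq_of_ne h] at this
  · intro ε hε
    simp only [Finset.mem_filter, Finset.mem_univ, true_and, Finset.card_eq_one] at hε
    obtain ⟨l, hl⟩ := hε
    refine ⟨l, Finset.mem_univ l, ?_⟩
    funext i
    have hi : ε i = -1 ↔ i = l := by simpa using Finset.ext_iff.1 hl i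
    by_cases h : i = l
    · subst h; simp [hi.2 rfl]
    · rcases Int.units_eq_one_or (ε i) with h1 | h1
      · simp [h, h1]
      · exact absurd (hi.1 h1) h
  · intro l _
    rw [Finset.prod_eq_single l (fun i _ hi => by simp [hi]) (by simp)]
    simp

/-- A strictly decreasing vector with entries in `s` is the same thing as a subset of `s`. -/
theorem sum_strictAnti_eq_sum_powersetCard {M : Type*} [AddCommMonoid M] (d : ℕ) (s : Finset ℕ)
    (f : Finset ℕ → M) :
    ∑ m ∈ (Fintype.piFinset fun _ : Fin d => s).filter (fun m => ∀ i j : Fin d, i < j → m j < m i),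
      f (Finset.univ.image m) = ∑ A ∈ s.powersetCard d, f A := by
  have hanti : ∀ m : Fin d → ℕ, (∀ i j : Fin d, i < j → m j < m i) → StrictAnti m :=
    fun m hm i j hij => hm i j hij
  refine Finset.sum_bij (fun m _ => Finset.univ.image m) ?_ ?_ ?_ fun _ _ => rfl
  · intro m hm
    rw [Finset.mem_filter, Fintype.mem_piFinset] at hm
    refine Finset.mem_powersetCard.2 ⟨fun x hx => ?_, ?_⟩
    · obtain ⟨i, -, rfl⟩ := Finset.mem_image.1 hx
      exact hm.1 i
    · rw [Finset.card_image_of_injective _ (hanti m hm.2).injective, Finset.card_fin]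
  · intro m hm m' hm' h
    rw [Finset.mem_filter] at hm hm'
    refine ((hanti m hm.2).range_inj (hanti m' hm'.2)).1 ?_
    simpa using congrArg (fun A : Finset ℕ => (A : Set ℕ)) h
  · intro A hA
    obtain ⟨hAs, hc⟩ := Finset.mem_powersetCard.1 hA
    refine ⟨fun i => A.orderEmbOfFin hc i.rev, ?_, ?_⟩
    · refine Finset.mem_filter.2 ⟨Fintype.mem_piFinset.2 fun i =>
        hAs (A.orderEmbOfFin_mem hc _), fun i j hij => ?_⟩
      simpa using hij
    · apply Finset.coe_injective
      rw [Finset.coe_image, Finset.coe_univ, Set.image_univ]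
      have := (Fin.rev_surjective (n := d)).range_comp (A.orderEmbOfFin hc)
      rw [Finset.range_orderEmbOfFin] at this
      exact this

/-- The truncation at `N` of the restricted sum `A₁(2n, d)`. -/
noncomputable def restrictedPartialSum (n d N : ℕ) : ℝ :=
  ∑ j ∈ (Finset.piAntidiag (Finset.univ : Finset (Fin d)) n).filter (fun j => ∀ i, 0 < j i),
    ∑ ε ∈ (Finset.univ : Finset (Fin d → ℤˣ)).filter
        (fun ε => (Finset.univ.filter fun i => ε i = -1).card = 1),
      eulerPartialSum (fun i => 2 * j i) ε N

theorem tendsto_restrictedPartialSum (n d : ℕ) :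
    Tendsto (restrictedPartialSum n d) atTop (𝓝 (restrictedSum 1 n d)) := by
  refine tendsto_finsetSum _ fun j hj => tendsto_finsetSum _ fun ε _ =>
    tendsto_eulerPartialSum _ ε fun i => ?_
  have := (Finset.mem_filter.1 hj).2 i
  lia

theorem restrictedPartialSum_eq_sum_powersetCard (n d N : ℕ) :
    restrictedPartialSum n d N = ∑ A ∈ (Finset.Icc 1 N).powersetCard d,
      (∑ l ∈ A, (-1 : ℝ) ^ l) * coeff n (∏ m ∈ A, geomSeries m) := by
  rw [← sum_strictAnti_eq_sum_powersetCard]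
  simp only [restrictedPartialSum, eulerPartialSum]
  rw [Finset.sum_congr rfl fun j _ => Finset.sum_comm, Finset.sum_comm]
  refine Finset.sum_congr rfl fun m hm => ?_
  have hinj : Function.Injective m :=
    StrictAnti.injective fun i j hij => (Finset.mem_filter.1 hm).2 i j hij
  rw [Finset.sum_image hinj.injOn, Finset.prod_image hinj.injOn, ← sum_prod_inv_pow_eq_coeff,
    ← sum_prod_sign_pow_eq, Finset.mul_sum]
  refine Finset.sum_congr rfl fun j _ => ?_
  rw [Finset.sum_mul]
  refine Finset.sum_congr rfl fun ε _ => ?_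
  rw [← Finset.prod_mul_distrib]
  rfl

/-! ### The generating function of the truncations -/

/-- For a family with `(1 + y * u m) * v m = w m`, the generating function of the sums of
`∏ m ∈ A, u m`, weighted by `∑ l ∈ A, c l`, is `∏ (1 + y * u m)` times its logarithmic derivative
`∑ c l * y * u l / (1 + y * u l)`; here the denominators `v m` are cleared. -/
theorem sum_powerset_weighted_mul_prod {R ι : Type*} [CommRing R] [DecidableEq ι] (s : Finset ι)
    (y : R) (c u v w : ι → R) (h : ∀ m, (1 + y * u m) * v m = w m) :
    (∑ A ∈ s.powerset, (∑ l ∈ A, c l) * (y ^ A.card * ∏ m ∈ A, u m)) * ∏ m ∈ s, v m =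
      ∑ l ∈ s, c l * (y * (u l * v l)) * ∏ m ∈ s.erase l, w m := by
  induction s using Finset.induction_on with
  | empty => simp
  | insert a s ha ih =>
    have hF : (∑ A ∈ s.powerset, y ^ A.card * ∏ m ∈ A, u m) * ∏ m ∈ s, v m = ∏ m ∈ s, w m := by
      simp_rw [← h, Finset.prod_mul_distrib, Finset.prod_one_add, Finset.prod_mul_distrib,
        Finset.prod_const]
    have hins : ∑ A ∈ s.powerset, (∑ l ∈ insert a A, c l) *
        (y ^ (insert a A).card * ∏ m ∈ insert a A, u m) =
        y * u a * (c a * (∑ A ∈ s.powerset, y ^ A.card * ∏ m ∈ A, u m) +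
          ∑ A ∈ s.powerset, (∑ l ∈ A, c l) * (y ^ A.card * ∏ m ∈ A, u m)) := by
      rw [Finset.mul_sum, ← Finset.sum_add_distrib, Finset.mul_sum]
      refine Finset.sum_congr rfl fun A hA => ?_
      have haA : a ∉ A := fun h' => ha (Finset.mem_powerset.1 hA h')
      rw [Finset.sum_insert haA, Finset.prod_insert haA, Finset.card_insert_of_notMem haA]
      ring
    have herase : ∑ l ∈ s, c l * (y * (u l * v l)) * ∏ m ∈ (insert a s).erase l, w m =
        w a * ∑ l ∈ s, c l * (y * (u l * v l)) * ∏ m ∈ s.erase l, w m := by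
      rw [Finset.mul_sum]
      refine Finset.sum_congr rfl fun l hl => ?_
      have hla : a ≠ l := fun h' => ha (h' ▸ hl)
      rw [Finset.erase_insert_of_ne hla,
        Finset.prod_insert fun h' => ha (Finset.mem_of_mem_erase h')]
      ring
    rw [Finset.sum_powerset_insert ha, hins, Finset.prod_insert ha, Finset.sum_insert ha,
      Finset.erase_insert ha, herase, ← ih, ← hF, ← h a]
    ring

/-- The factor `1 - x / m²` of the sine product. -/
noncomputable def sineFactor (m : ℕ) : ℝ⟦X⟧ :=
  1 - C (((m : ℝ) ^ 2)⁻¹) * X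

theorem geomSeries_mul_sineFactor (m : ℕ) :
    geomSeries m * sineFactor m = C (((m : ℝ) ^ 2)⁻¹) * X := by
  rw [sineFactor, mul_sub, mul_one, mul_left_comm]
  ext n
  rcases n with _ | n
  · simp [geomSeries]
  · rw [map_sub, coeff_C_mul, coeff_succ_mul_X, coeff_C_mul]
    rcases n with _ | n
    · simp [geomSeries]
    · simp [geomSeries, coeff_X]
      rw [← mul_inv, ← pow_add, sub_eq_zero]
      ring_nf

/-- The truncated sine product `∏_{m ≤ N} (1 - x / m²)`. -/
noncomputable def sincPartial (N : ℕ) : ℝ⟦X⟧ :=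
  ∏ m ∈ Finset.Icc 1 N, sineFactor m

/-- The truncated generating function `∑_{m ≤ N} c_m x / (m² - x)`, whose coefficients are
`∑_{m ≤ N} c_m / m ^ (2 * k)`. -/
noncomputable def dirichletPartial (c : ℕ → ℝ) (N : ℕ) : ℝ⟦X⟧ :=
  ∑ m ∈ Finset.Icc 1 N, C (c m) * geomSeries m

theorem sincPartial_mul_dirichletPartial (c : ℕ → ℝ) (N : ℕ) :
    sincPartial N * dirichletPartial c N = ∑ l ∈ Finset.Icc 1 N,
      C (c l) * (C (((l : ℝ) ^ 2)⁻¹) * X) * ∏ m ∈ (Finset.Icc 1 N).erase l, sineFactor m := by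
  rw [sincPartial, dirichletPartial, Finset.mul_sum]
  refine Finset.sum_congr rfl fun l hl => ?_
  rw [← Finset.mul_prod_erase _ _ hl, ← geomSeries_mul_sineFactor]
  ring

/-- The generating function `∑ x ^ n y ^ d` of the restricted sums truncated at `N`. The outer
variable is `x`, the coefficients are power series in `y`. -/
noncomputable def restrictedPartialSeries (N : ℕ) : ℝ⟦X⟧⟦X⟧ :=
  PowerSeries.mk fun n => PowerSeries.mk fun d => restrictedPartialSum n d N

theorem restrictedPartialSeries_eq (N : ℕ) :
    restrictedPartialSeries N = ∑ A ∈ (Finset.Icc 1 N).powerset,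
      (∑ l ∈ A, (C (C ((-1 : ℝ) ^ l)) : ℝ⟦X⟧⟦X⟧)) *
        (C X ^ A.card * ∏ m ∈ A, PowerSeries.map C (geomSeries m)) := by
  ext n d
  rw [map_sum, map_sum]
  have hterm : ∀ A : Finset ℕ, coeff d (coeff n ((∑ l ∈ A, (C (C ((-1 : ℝ) ^ l)) : ℝ⟦X⟧⟦X⟧)) *
      (C X ^ A.card * ∏ m ∈ A, PowerSeries.map C (geomSeries m)))) =
      if A.card = d then (∑ l ∈ A, (-1 : ℝ) ^ l) * coeff n (∏ m ∈ A, geomSeries m) else 0 := by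
    intro A
    rw [← map_prod, ← map_sum, ← map_sum, ← map_pow, coeff_C_mul, coeff_C_mul, coeff_C_mul,
      coeff_map, coeff_mul_C, coeff_X_pow]
    by_cases h : A.card = d
    · simp [h]
    · simp [h, Ne.symm h]
  simp_rw [hterm]
  rw [← Finset.sum_filter, ← Finset.powersetCard_eq_filter,
    ← restrictedPartialSum_eq_sum_powersetCard]
  simp [restrictedPartialSeries]

theorem rescale_C {R : Type*} [CommRing R] (a r : R) : rescale a (C r) = C r := by
  ext n
  rcases n with _ | n <;> simp [coeff_rescale, coeff_C]

theorem one_sub_mul_restrictedPartialSeries (N : ℕ) :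
    (1 - C X) * restrictedPartialSeries N * PowerSeries.map C (sincPartial N) =
      C X * rescale (1 - X)
        (PowerSeries.map C (sincPartial N * dirichletPartial (fun m => (-1) ^ m) N)) := by
  have hfactor : ∀ m,
      (1 + C X * PowerSeries.map C (geomSeries m)) * PowerSeries.map C (sineFactor m) =
        rescale (1 - X) (PowerSeries.map C (sineFactor m)) := by
    intro m
    rw [add_mul, mul_assoc, ← map_mul, geomSeries_mul_sineFactor]
    simp only [sineFactor, map_sub, map_one, map_mul, map_C, map_X, rescale_X, rescale_C]
    ring
  rw [restrictedPartialSeries_eq, mul_assoc, sincPartial, map_prod,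
    sum_powerset_weighted_mul_prod _ _ _ _ _ _ hfactor, ← sincPartial,
    sincPartial_mul_dirichletPartial, map_sum, map_sum, Finset.mul_sum, Finset.mul_sum]
  refine Finset.sum_congr rfl fun l _ => ?_
  rw [← map_mul (PowerSeries.map (C (R := ℝ))), geomSeries_mul_sineFactor]
  simp only [map_sub, map_one, map_mul, map_prod, map_C, map_X, rescale_X, rescale_C]
  ring

/-! ### Limits of the depth one series and of the sine product -/

/-- The series `sin (π t) / (π t)` in the variable `x = t²`. -/
noncomputable def sincSeries : ℝ⟦X⟧ :=
  PowerSeries.mk fun k => (-1) ^ k * Real.pi ^ (2 * k) / (2 * k + 1).factorial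

/-- The series `cos (π t)` in the variable `x = t²`. -/
noncomputable def cosSeries : ℝ⟦X⟧ :=
  PowerSeries.mk fun k => (-1) ^ k * Real.pi ^ (2 * k) / (2 * k).factorial

/-- The series `∑_{k ≥ 1} x ^ k * ∑_m ε ^ m / m ^ (2 * k)`. -/
noncomputable def depthOneSeries (ε : ℤˣ) : ℝ⟦X⟧ :=
  PowerSeries.mk fun k => if k = 0 then 0 else eulerSum (fun _ : Fin 1 => 2 * k) (fun _ => ε)

theorem tendsto_coeff_dirichletPartial (ε : ℤˣ) (k : ℕ) :
    Tendsto (fun N => coeff k (dirichletPartial (fun m => ((ε : ℤ) : ℝ) ^ m) N)) atTop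
      (𝓝 (coeff k (depthOneSeries ε))) := by
  rcases Nat.eq_zero_or_pos k with rfl | hk
  · simp [dirichletPartial, depthOneSeries, geomSeries]
  · have h := tendsto_eulerPartialSum (fun _ : Fin 1 => 2 * k) (fun _ => ε) fun _ => by lia
    simp only [depthOneSeries, coeff_mk, hk.ne', if_false]
    refine h.congr fun N => ?_
    rw [eulerPartialSum_one, dirichletPartial, map_sum]
    refine Finset.sum_congr rfl fun m _ => ?_
    rw [coeff_C_mul, geomSeries, coeff_mk, if_neg hk.ne', div_eq_mul_inv]

theorem eulerSum_one_eq_of_hasSum {s : ℕ} (hs : 2 ≤ s) (ε : ℤˣ) {a : ℝ}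
    (h : HasSum (fun m : ℕ => ((ε : ℤ) : ℝ) ^ m / (m : ℝ) ^ s) a) :
    eulerSum (fun _ : Fin 1 => s) (fun _ => ε) = a := by
  refine tendsto_nhds_unique (tendsto_eulerPartialSum _ _ fun _ => hs) ?_
  refine ((tendsto_add_atTop_iff_nat 1).2 h.tendsto_sum_nat).congr fun N => ?_
  have h0 : s ≠ 0 := by lia
  have hIcc : Finset.Icc 1 N = Finset.Ico (0 + 1) (N + 1) := by
    ext m
    simp only [Finset.mem_Icc, Finset.mem_Ico]
    lia
  rw [eulerPartialSum_one, Finset.sum_range_succ', hIcc, ← Finset.sum_Ico_add',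
    ← Finset.range_eq_Ico]
  simp [h0]

theorem sum_antidiagonal_two_mul_add_one {R : Type*} [AddCommMonoid R] (f : ℕ → ℕ → R) (n : ℕ) :
    ∑ p ∈ Finset.HasAntidiagonal.antidiagonal (2 * n + 1), f p.1 p.2 =
      ∑ p ∈ Finset.HasAntidiagonal.antidiagonal n,
        (f (2 * p.1) (2 * p.2 + 1) + f (2 * p.1 + 1) (2 * p.2)) := by
  have hpair : ∀ (g : ℕ → R) (m : ℕ), ∑ k ∈ Finset.range (2 * m), g k =
      ∑ i ∈ Finset.range m, (g (2 * i) + g (2 * i + 1)) := by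
    intro g m
    induction m with
    | zero => simp
    | succ m ih =>
      rw [show 2 * (m + 1) = 2 * m + 1 + 1 by ring, Finset.sum_range_succ, Finset.sum_range_succ,
        ih, Finset.sum_range_succ, add_assoc]
  rw [Finset.Nat.sum_antidiagonal_eq_sum_range_succ_mk,
    Finset.Nat.sum_antidiagonal_eq_sum_range_succ_mk,
    show (2 * n + 1).succ = 2 * (n + 1) by lia, hpair]
  refine Finset.sum_congr rfl fun i hi => ?_
  have := Finset.mem_range.1 hi
  congr 2 <;> lia

/-- The odd coefficients of `(∑ Bₙ(x) t ^ n / n!) (exp (t / 2) - exp (-t / 2)) =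
t exp ((x - 1 / 2) t)`. As the second factor is odd, only even Bernoulli polynomials contribute. -/
theorem sum_antidiagonal_bernoulli (x : ℝ) (n : ℕ) :
    ∑ p ∈ Finset.HasAntidiagonal.antidiagonal n,
      ((Polynomial.bernoulli (2 * p.1)).map (algebraMap ℚ ℝ)).eval x / (2 * p.1).factorial *
        ((1 / 4) ^ p.2 / (2 * p.2 + 1).factorial) = (x - 1 / 2) ^ (2 * n) / (2 * n).factorial := by
  have hexp : ∀ (a : ℝ) (k : ℕ), coeff k (rescale a (exp ℝ)) = a ^ k / k.factorial := by
    intro a k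
    simp [coeff_rescale, coeff_exp, div_eq_mul_inv]
  have hgen := congrArg (fun f => f * rescale (-(1 / 2) : ℝ) (exp ℝ))
    (Polynomial.bernoulli_generating_function x)
  have h1 : (exp ℝ - 1) * rescale (-(1 / 2) : ℝ) (exp ℝ) =
      rescale (1 / 2 : ℝ) (exp ℝ) - rescale (-(1 / 2) : ℝ) (exp ℝ) := by
    have := exp_mul_exp_eq_exp_add (1 : ℝ) (-(1 / 2))
    rw [rescale_one, RingHom.id_apply] at this
    rw [sub_mul, one_mul, this]
    norm_num
  rw [mul_assoc, h1, mul_assoc, exp_mul_exp_eq_exp_add] at hgen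
  have hc := congrArg (coeff (2 * n + 1)) hgen
  rw [coeff_succ_X_mul, hexp, coeff_mul, sum_antidiagonal_two_mul_add_one
    (fun k l => coeff k (PowerSeries.mk fun n => Polynomial.aeval x
      ((1 / n.factorial : ℚ) • Polynomial.bernoulli n)) *
      coeff l (rescale (1 / 2 : ℝ) (exp ℝ) - rescale (-(1 / 2) : ℝ) (exp ℝ)))] at hc
  rw [sub_eq_add_neg, ← hc]
  refine Finset.sum_congr rfl fun p _ => ?_
  rw [map_sub, map_sub, hexp, hexp, hexp, hexp, coeff_mk, map_smul, Polynomial.aeval_def,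
    Polynomial.eval_map, (even_two_mul p.2).neg_pow, sub_self, mul_zero, add_zero,
    Odd.neg_pow ⟨p.2, rfl⟩, pow_succ, pow_mul, Rat.smul_def]
  push_cast
  ring

/-- If `ε ^ m = cos (2 π m x)` for all `m`, the Fourier expansion of the Bernoulli polynomials at
`x` evaluates the depth one sums with sign `ε`. -/
theorem one_sub_depthOneSeries_mul_sincSeries {x : ℝ} (hx : x ∈ Set.Icc (0 : ℝ) 1) (ε : ℤˣ)
    (hε : ∀ m : ℕ, Real.cos (2 * Real.pi * m * x) = ((ε : ℤ) : ℝ) ^ m) :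
    (1 - 2 * depthOneSeries ε) * sincSeries = PowerSeries.mk fun n =>
      (-1) ^ n * (2 * Real.pi) ^ (2 * n) * ((x - 1 / 2) ^ (2 * n) / (2 * n).factorial) := by
  have hcoeff : 1 - 2 * depthOneSeries ε = PowerSeries.mk fun k =>
      (-1) ^ k * (2 * Real.pi) ^ (2 * k) *
        (((Polynomial.bernoulli (2 * k)).map (algebraMap ℚ ℝ)).eval x / (2 * k).factorial) := by
    ext k
    have h2 : (2 : ℝ⟦X⟧) = C 2 := (map_ofNat C 2).symm
    rw [map_sub, h2, coeff_C_mul, depthOneSeries, coeff_mk, coeff_mk, coeff_one]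
    rcases Nat.eq_zero_or_pos k with rfl | hk
    · simp
    · have h := hasSum_one_div_nat_pow_mul_cos hk.ne' hx
      simp_rw [hε, one_div_mul_eq_div] at h
      rw [if_neg hk.ne', if_neg hk.ne', eulerSum_one_eq_of_hasSum (by lia) ε h]
      ring
  rw [hcoeff]
  ext n
  rw [coeff_mul, coeff_mk, ← sum_antidiagonal_bernoulli, Finset.mul_sum]
  refine Finset.sum_congr rfl fun p hp => ?_
  rw [sincSeries, coeff_mk, coeff_mk, ← Finset.HasAntidiagonal.mem_antidiagonal.1 hp]
  have h4 : (2 * Real.pi) ^ (2 * (p.1 + p.2)) * (1 / 4) ^ p.2 =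
      (2 * Real.pi) ^ (2 * p.1) * Real.pi ^ (2 * p.2) := by
    rw [mul_add, pow_add, mul_assoc, pow_mul _ 2 p.2, ← mul_pow, pow_mul Real.pi]
    ring_nf
  rw [pow_add]
  linear_combination (norm := (field_simp; ring_nf)) (-1) ^ p.1 * (-1) ^ p.2 *
    (((Polynomial.bernoulli (2 * p.1)).map (algebraMap ℚ ℝ)).eval x / (2 * p.1).factorial /
      (2 * p.2 + 1).factorial) * (-h4)

/-- The partial fraction expansion of `π t / sin (π t)`. -/
theorem one_sub_altZetaSeries_mul_sincSeries :
    (1 - 2 * depthOneSeries (-1)) * sincSeries = 1 := by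
  rw [one_sub_depthOneSeries_mul_sincSeries (x := 1 / 2) (by norm_num)]
  · ext n
    rcases Nat.eq_zero_or_pos n with rfl | hn
    · simp
    · simp [coeff_one, hn.ne']
  · intro m
    rw [show 2 * Real.pi * m * (1 / 2) = m * Real.pi by ring, Real.cos_nat_mul_pi]
    simp

/-- The partial fraction expansion of `π t cot (π t)`. -/
theorem one_sub_zetaSeries_mul_sincSeries :
    (1 - 2 * depthOneSeries 1) * sincSeries = cosSeries := by
  rw [one_sub_depthOneSeries_mul_sincSeries (x := 0) (by norm_num) 1 (by simp)]
  ext n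
  rw [coeff_mk, cosSeries, coeff_mk, mul_pow, zero_sub, (even_two_mul n).neg_pow, one_div, inv_pow]
  field_simp

theorem coeff_X_mul_derivative (f : ℝ⟦X⟧) (k : ℕ) :
    coeff k (X * derivative ℝ f) = k * coeff k f := by
  rcases k with _ | k
  · simp
  · rw [coeff_succ_X_mul, coeff_derivative]
    push_cast
    ring

theorem X_mul_derivative_sincPartial (N : ℕ) :
    X * derivative ℝ (sincPartial N) = -(sincPartial N * dirichletPartial (fun _ => 1) N) := by
  simp only [sincPartial, dirichletPartial, map_one, one_mul]
  induction Finset.Icc 1 N using Finset.induction_on with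
  | empty => simp
  | insert a s ha ih =>
    have hd : X * derivative ℝ (sineFactor a) = -(geomSeries a * sineFactor a) := by
      rw [geomSeries_mul_sineFactor]
      simp [sineFactor, Derivation.leibniz]
      ring
    rw [Finset.prod_insert ha, Finset.sum_insert ha, Derivation.leibniz, smul_eq_mul, smul_eq_mul]
    linear_combination (∏ m ∈ s, sineFactor m) * hd + sineFactor a * ih

theorem X_mul_derivative_sincSeries :
    X * derivative ℝ sincSeries = -(sincSeries * depthOneSeries 1) := by
  have h : 2 * (X * derivative ℝ sincSeries) + sincSeries = cosSeries := by
    ext k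
    have h2 : (2 : ℝ⟦X⟧) = C 2 := (map_ofNat C 2).symm
    rw [map_add, h2, coeff_C_mul, coeff_X_mul_derivative, sincSeries, cosSeries, coeff_mk, coeff_mk,
      Nat.factorial_succ]
    push_cast
    field_simp
  have h2 : (2 : ℝ⟦X⟧) ≠ 0 := by
    intro h0
    have := congrArg (constantCoeff (R := ℝ)) h0
    rw [map_ofNat, map_zero] at this
    exact two_ne_zero this
  refine mul_left_cancel₀ h2 ?_
  linear_combination h - one_sub_zetaSeries_mul_sincSeries

/-- The sine product, coefficientwise: the logarithmic derivatives of the truncated product and of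
`sincSeries` determine their coefficients recursively, and the former converge to the latter. -/
theorem tendsto_coeff_sincPartial (k : ℕ) :
    Tendsto (fun N => coeff k (sincPartial N)) atTop (𝓝 (coeff k sincSeries)) := by
  induction k using Nat.strong_induction_on with
  | _ k ih =>
    rcases Nat.eq_zero_or_pos k with rfl | hk
    · simp [sincPartial, sincSeries, sineFactor, map_prod]
    · have hk' : (k : ℝ) ≠ 0 := by exact_mod_cast hk.ne'
      have hrec : ∀ f g : ℝ⟦X⟧, X * derivative ℝ f = -(f * g) →
          coeff k f = -(k : ℝ)⁻¹ *
            ∑ p ∈ Finset.HasAntidiagonal.antidiagonal k, coeff p.1 f * coeff p.2 g := by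
        intro f g h
        have := congrArg (coeff k) h
        rw [coeff_X_mul_derivative, map_neg, coeff_mul] at this
        field_simp
        linear_combination this
      rw [hrec _ _ X_mul_derivative_sincSeries]
      simp_rw [fun N => hrec _ _ (X_mul_derivative_sincPartial N)]
      refine (tendsto_finsetSum _ fun p hp => ?_).const_mul _
      rw [Finset.HasAntidiagonal.mem_antidiagonal] at hp
      -- The term with `p.2 = 0` vanishes, so the induction hypothesis covers all others.
      rcases Nat.eq_zero_or_pos p.2 with h0 | h0
      · simp [h0, dirichletPartial, geomSeries, depthOneSeries]
      · refine (ih p.1 (by lia)).mul ?_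
        simpa using tendsto_coeff_dirichletPartial 1 p.2

/-! ### The generating function of the restricted sums -/

/-- The generating function `∑ x ^ n y ^ d` of the restricted sums `A₁(2n, d)`. The outer variable
is `x`, the coefficients are power series in `y`. -/
noncomputable def restrictedSeries : ℝ⟦X⟧⟦X⟧ :=
  PowerSeries.mk fun n => PowerSeries.mk fun d => restrictedSum 1 n d

open scoped PowerSeries.WithPiTopology in
theorem one_sub_mul_restrictedSeries :
    (1 - C X) * restrictedSeries * PowerSeries.map C sincSeries = C X * rescale (1 - X)
      (PowerSeries.map C (sincSeries * depthOneSeries (-1))) := by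
  have hmap : ∀ {f : ℕ → ℝ⟦X⟧} {g : ℝ⟦X⟧}, Tendsto f atTop (𝓝 g) →
      Tendsto (fun N => PowerSeries.map (C (R := ℝ)) (f N)) atTop (𝓝 (PowerSeries.map C g)) := by
    intro f g h
    rw [WithPiTopology.tendsto_iff_coeff_tendsto] at h ⊢
    intro n
    rw [WithPiTopology.tendsto_iff_coeff_tendsto]
    intro d
    simp only [coeff_map, coeff_C]
    split_ifs
    · exact h n
    · exact tendsto_const_nhds
  have hrescale : ∀ {f : ℕ → ℝ⟦X⟧⟦X⟧} {g : ℝ⟦X⟧⟦X⟧}, Tendsto f atTop (𝓝 g) →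
      Tendsto (fun N => rescale (1 - X) (f N)) atTop (𝓝 (rescale (1 - X) g)) := by
    intro f g h
    rw [WithPiTopology.tendsto_iff_coeff_tendsto] at h ⊢
    intro n
    simp only [coeff_rescale]
    exact (h n).const_mul _
  have hS : Tendsto sincPartial atTop (𝓝 sincSeries) :=
    (WithPiTopology.tendsto_iff_coeff_tendsto _ _ _ _).2 tendsto_coeff_sincPartial
  have hT : Tendsto (dirichletPartial fun m => (-1) ^ m) atTop (𝓝 (depthOneSeries (-1))) := by
    refine (WithPiTopology.tendsto_iff_coeff_tendsto _ _ _ _).2 fun k => ?_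
    simpa using tendsto_coeff_dirichletPartial (-1) k
  have hE : Tendsto restrictedPartialSeries atTop (𝓝 restrictedSeries) := by
    refine (WithPiTopology.tendsto_iff_coeff_tendsto _ _ _ _).2 fun n =>
      (WithPiTopology.tendsto_iff_coeff_tendsto _ _ _ _).2 fun d => ?_
    simpa [restrictedPartialSeries, restrictedSeries] using tendsto_restrictedPartialSum n d
  refine tendsto_nhds_unique ((hE.const_mul (1 - C X)).mul (hmap hS)) ?_
  simp_rw [one_sub_mul_restrictedPartialSeries]
  exact (hrescale (hmap (hS.mul hT))).const_mul _

/-- The addition formula `sin (s z) = cos (r z) sin z - sin (r z) cos z` for `s = 1 - r`. -/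
theorem rescale_sq_sincSeries {s r : ℝ⟦X⟧} (h : s = 1 - r) :
    C s * rescale (s ^ 2) (PowerSeries.map C sincSeries) =
      rescale (r ^ 2) (PowerSeries.map C cosSeries) * PowerSeries.map C sincSeries -
        C r * rescale (r ^ 2) (PowerSeries.map C sincSeries) * PowerSeries.map C cosSeries := by
  have hQ : ∀ q : ℚ, algebraMap ℚ ℝ⟦X⟧ q = C (q : ℝ) := fun q =>
    RingHom.congr_fun (Subsingleton.elim (algebraMap ℚ ℝ⟦X⟧) ((C (R := ℝ)).comp
      (algebraMap ℚ ℝ))) q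
  have hexp : ∀ m : ℕ, s ^ m * C (m.factorial : ℝ)⁻¹ =
      ∑ p ∈ Finset.HasAntidiagonal.antidiagonal m,
        (-r) ^ p.1 * C (p.1.factorial : ℝ)⁻¹ * C (p.2.factorial : ℝ)⁻¹ := by
    intro m
    have := congrArg (coeff m) (exp_mul_exp_eq_exp_add (-r) (1 : ℝ⟦X⟧))
    rw [neg_add_eq_sub, ← h] at this
    simpa [coeff_mul, coeff_rescale, coeff_exp, hQ] using this.symm
  ext1 n
  have hn := hexp (2 * n + 1)
  rw [sum_antidiagonal_two_mul_add_one
    fun a b => (-r) ^ a * C (a.factorial : ℝ)⁻¹ * C (b.factorial : ℝ)⁻¹] at hn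
  have hsplit : ∀ (k m : ℕ), C ((-1 : ℝ) ^ k * Real.pi ^ (2 * k) / m.factorial) =
      C ((-1 : ℝ) ^ k * Real.pi ^ (2 * k)) * C (m.factorial : ℝ)⁻¹ := by
    intro k m
    rw [← map_mul, div_eq_mul_inv]
  rw [map_sub, coeff_C_mul, mul_assoc, coeff_C_mul, coeff_mul, coeff_mul, Finset.mul_sum,
    ← Finset.sum_sub_distrib]
  simp only [coeff_rescale, coeff_map, sincSeries, cosSeries, coeff_mk, hsplit]
  calc s * ((s ^ 2) ^ n * (C ((-1 : ℝ) ^ n * Real.pi ^ (2 * n)) * C ((2 * n + 1).factorial : ℝ)⁻¹))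
      = C ((-1 : ℝ) ^ n * Real.pi ^ (2 * n)) * (s ^ (2 * n + 1) *
          C ((2 * n + 1).factorial : ℝ)⁻¹) := by ring
    _ = _ := by
      rw [hn, Finset.mul_sum]
      refine Finset.sum_congr rfl fun p hp => ?_
      rw [← (Finset.HasAntidiagonal.mem_antidiagonal.1 hp), (even_two_mul p.1).neg_pow,
        Odd.neg_pow ⟨p.1, rfl⟩]
      have : (-1 : ℝ) ^ (p.1 + p.2) * Real.pi ^ (2 * (p.1 + p.2)) =
          ((-1) ^ p.1 * Real.pi ^ (2 * p.1)) * ((-1) ^ p.2 * Real.pi ^ (2 * p.2)) := by ring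
      rw [this, map_mul]
      ring

/-- The closed form of the generating function, with `s = √(1 - y)` and `r = 1 - s`. The
denominators are cleared, and `sin (π s t) / sin (π t)` is expanded by the addition formula into
`cos (π r t) - cot (π t) * sin (π r t)`, whose coefficients have low order terms in `r`. -/
theorem restrictedSeries_closed_form {s r : ℝ⟦X⟧} (h : s = 1 - r) (hs : s ^ 2 = 1 - X) :
    2 * C (s ^ 3) * restrictedSeries = C X * (rescale (r ^ 2) (PowerSeries.map C cosSeries) -
      C r * rescale (r ^ 2) (PowerSeries.map C sincSeries) *
        PowerSeries.map C (1 - 2 * depthOneSeries 1) -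
      C s * PowerSeries.map C (1 - 2 * depthOneSeries (-1))) := by
  have hS0 : PowerSeries.map C sincSeries ≠ (0 : ℝ⟦X⟧⟦X⟧) := by
    intro h0
    have := congrArg (fun f => coeff 0 (coeff 0 f)) h0
    simp only [coeff_map, sincSeries, coeff_mk, coeff_zero_C, map_zero] at this
    norm_num at this
  refine mul_right_cancel₀ hS0 ?_
  have hsin := rescale_sq_sincSeries h
  have hG := one_sub_mul_restrictedSeries
  have hST : 2 * (sincSeries * depthOneSeries (-1)) = sincSeries - 1 := by
    linear_combination -one_sub_altZetaSeries_mul_sincSeries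
  have hST' := congrArg (fun f => rescale (s ^ 2) (PowerSeries.map (C (R := ℝ)) f)) hST
  have hZ := congrArg (PowerSeries.map (C (R := ℝ))) one_sub_zetaSeries_mul_sincSeries
  have hT := congrArg (PowerSeries.map (C (R := ℝ))) one_sub_altZetaSeries_mul_sincSeries
  rw [← hs] at hG
  have h2 : rescale (s ^ 2) (PowerSeries.map (C (R := ℝ)) (2 : ℝ⟦X⟧)) = 2 := by
    rw [map_ofNat, map_ofNat]
  simp only [map_mul _ (2 : ℝ⟦X⟧), map_mul _ (PowerSeries.map (C (R := ℝ)) (2 : ℝ⟦X⟧)), h2, map_one,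
    map_sub] at hST'
  rw [map_mul] at hZ hT
  rw [map_one] at hT
  have hC : C (s ^ 3) = C s * (1 - C X) := by
    rw [← map_one (C (R := ℝ⟦X⟧)), ← map_sub, ← map_mul, ← hs]
    ring_nf
  rw [hC]
  linear_combination 2 * C s * hG + C s * C X * hST' + C X * hsin
    + C X * C r * rescale (r ^ 2) (PowerSeries.map C sincSeries) * hZ + C X * C s * hT

/-! ### Coefficients of the closed form -/

/-- The binomial series `(1 - y) ^ a`. -/
noncomputable def oneSubPow (a : ℝ) : ℝ⟦X⟧ :=
  rescale (-1) (binomialSeries ℝ a)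

theorem oneSubPow_add (a b : ℝ) : oneSubPow (a + b) = oneSubPow a * oneSubPow b := by
  rw [oneSubPow, binomialSeries_add, map_mul, oneSubPow, oneSubPow]

theorem oneSubPow_zero : oneSubPow 0 = 1 := by
  rw [oneSubPow, binomialSeries_zero, map_one]

theorem oneSubPow_one : oneSubPow 1 = 1 - X := by
  have := binomialSeries_nat (R := ℝ) (A := ℝ) 1
  rw [Nat.cast_one] at this
  rw [oneSubPow, this, pow_one, map_add, map_one, rescale_neg_one_X, sub_eq_add_neg]

theorem oneSubPow_pow (a : ℝ) (k : ℕ) : oneSubPow a ^ k = oneSubPow (k * a) := by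
  induction k with
  | zero => simp [oneSubPow_zero]
  | succ k ih => rw [pow_succ, ih, ← oneSubPow_add]; push_cast; ring_nf

theorem coeff_oneSubPow (a : ℝ) (e : ℕ) :
    coeff e (oneSubPow a) = (-1) ^ e * Ring.choose a e := by
  simp [oneSubPow, coeff_rescale]

/-- The coefficients of `(1 - y) ^ (-3 / 2) * (1 - √(1 - y)) ^ m`. -/
theorem coeff_oneSubPow_mul_pow (m e : ℕ) :
    coeff e (oneSubPow (-3 / 2) * (1 - oneSubPow (1 / 2)) ^ m) = ∑ k ∈ Finset.range (m + 1),
      (-1) ^ (e + k) * (m.choose k : ℝ) * Ring.choose (((k : ℝ) - 3) / 2) e := by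
  rw [sub_eq_neg_add, add_pow, Finset.mul_sum, map_sum]
  refine Finset.sum_congr rfl fun k _ => ?_
  have h : oneSubPow (-3 / 2) * ((-oneSubPow (1 / 2)) ^ k * 1 ^ (m - k) * (m.choose k : ℝ⟦X⟧)) =
      C ((-1) ^ k * (m.choose k : ℝ)) * oneSubPow (((k : ℝ) - 3) / 2) := by
    rw [show ((k : ℝ) - 3) / 2 = -3 / 2 + k * (1 / 2) by ring, oneSubPow_add, ← oneSubPow_pow,
      neg_pow]
    simp only [map_mul, map_pow, map_neg, map_one, map_natCast, one_pow]
    ring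
  rw [h, coeff_C_mul, coeff_oneSubPow]
  ring

/-- The series `1 - √(1 - y)` is divisible by `y`. -/
theorem coeff_oneSubPow_mul_pow_eq_zero {m e : ℕ} (h : e < m) :
    coeff e (oneSubPow (-3 / 2) * (1 - oneSubPow (1 / 2)) ^ m) = 0 := by
  have hX : X ∣ 1 - oneSubPow (1 / 2) := by
    rw [X_dvd_iff, map_sub, map_one, ← coeff_zero_eq_constantCoeff_apply, coeff_oneSubPow]
    simp
  exact X_pow_dvd_iff.1 ((pow_dvd_pow_of_dvd hX m).mul_left _) e h

/-- The coefficient of `x ^ n y ^ (e + 1)` in the closed form. The cosine and the top coefficient of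
`sin (π r t)` carry powers of `r = 1 - √(1 - y)` that are too high to contribute. -/
theorem restrictedSum_one_succ {n e : ℕ} (h : e + 1 ≤ n) :
    restrictedSum 1 n (e + 1) = altZetaValue (2 * n) + ∑ j ∈ Finset.range ((e + 1) / 2),
      coeff j sincSeries * zetaValue (2 * n - 2 * j) *
        coeff e (oneSubPow (-3 / 2) * (1 - oneSubPow (1 / 2)) ^ (2 * j + 1)) := by
  set s := oneSubPow (1 / 2) with hs
  set r := 1 - s with hr
  set t := oneSubPow (-3 / 2) with ht
  have hs2 : s ^ 2 = 1 - X := by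
    rw [hs, oneSubPow_pow, ← oneSubPow_one]
    norm_num
  have hts : t * s ^ 3 = 1 := by
    rw [hs, oneSubPow_pow, ht, ← oneSubPow_add, ← oneSubPow_zero]
    norm_num
  have hgeom : t * s = oneSubPow (-1) := by
    rw [ht, hs, ← oneSubPow_add]
    norm_num
  have hgeom_coeff : coeff e (oneSubPow (-1)) = 1 := by
    have h1 : oneSubPow (-1) * (1 - X) = 1 := by
      rw [← oneSubPow_one, ← oneSubPow_add, neg_add_cancel, oneSubPow_zero]
    have h2 : oneSubPow (-1) = PowerSeries.mk 1 := by
      have h3 : (PowerSeries.mk 1 : ℝ⟦X⟧) * (1 - X) = 1 := mk_one_mul_one_sub_eq_one ℝ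
      calc oneSubPow (-1) = oneSubPow (-1) * (PowerSeries.mk 1 * (1 - X)) := by rw [h3, mul_one]
        _ = oneSubPow (-1) * (1 - X) * PowerSeries.mk 1 := by ring
        _ = _ := by rw [h1, one_mul]
    rw [h2, coeff_mk, Pi.one_apply]
  have hn : n ≠ 0 := by lia
  have hP := congrArg (fun f => coeff n (C t * f))
    (restrictedSeries_closed_form (s := s) (r := r) (sub_sub_cancel 1 s).symm hs2)
  have hL : C t * (2 * C (s ^ 3) * restrictedSeries) = 2 * restrictedSeries := by
    calc C t * (2 * C (s ^ 3) * restrictedSeries)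
        = C (t * s ^ 3) * (2 * restrictedSeries) := by rw [map_mul]; ring
      _ = _ := by rw [hts, map_one, one_mul]
  have hR : ∀ A B D E : ℝ⟦X⟧⟦X⟧, C t * (C X * (A - C r * B * D - C s * E)) =
      C X * (C t * A - C (t * r) * (B * D) - C (t * s) * E) := by
    intro A B D E
    simp only [map_mul]
    ring
  simp only [hL, hR, hgeom] at hP
  have h2P : (2 : ℝ⟦X⟧⟦X⟧) = C (C 2) := by rw [map_ofNat, map_ofNat]
  have h2S : (2 : ℝ⟦X⟧) = C 2 := (map_ofNat C 2).symm
  have hdepth : ∀ (ε : ℤˣ) (k : ℕ), k ≠ 0 → coeff k (1 - 2 * depthOneSeries ε) =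
      -2 * eulerSum (fun _ : Fin 1 => 2 * k) (fun _ => ε) := by
    intro ε k hk
    rw [map_sub, h2S, coeff_C_mul, coeff_one, if_neg hk, depthOneSeries, coeff_mk, if_neg hk]
    ring
  rw [h2P, coeff_C_mul, coeff_C_mul, map_sub, map_sub, coeff_C_mul, coeff_C_mul, coeff_C_mul,
    coeff_mul] at hP
  simp only [coeff_rescale, coeff_map] at hP
  have hc := congrArg (coeff (e + 1)) hP
  rw [coeff_C_mul, coeff_succ_X_mul, map_sub, map_sub, coeff_mul_C, hgeom_coeff, one_mul,
    hdepth _ _ hn, ← mul_assoc, coeff_mul_C, ← pow_mul,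
    coeff_oneSubPow_mul_pow_eq_zero (by lia), zero_mul, Finset.mul_sum, map_sum] at hc
  have hterm : ∀ p : ℕ × ℕ, coeff e (t * r * ((r ^ 2) ^ p.1 * C (coeff p.1 sincSeries) *
      C (coeff p.2 (1 - 2 * depthOneSeries 1)))) =
      coeff p.1 sincSeries * coeff p.2 (1 - 2 * depthOneSeries 1) *
        coeff e (t * r ^ (2 * p.1 + 1)) := by
    intro p
    rw [← coeff_C_mul, map_mul (C (R := ℝ))]
    exact congrArg (coeff e) (by ring_nf)
  simp_rw [hterm] at hc
  rw [Finset.Nat.sum_antidiagonal_eq_sum_range_succ_mk] at hc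
  -- Only `2 * j + 1 ≤ e` contributes, and then `j < n` as `e < n`.
  rw [← Finset.sum_subset (s₁ := Finset.range ((e + 1) / 2))
    (Finset.range_mono (by lia)) fun j _ hj => by
      rw [Finset.mem_range] at hj
      rw [coeff_oneSubPow_mul_pow_eq_zero (by lia), mul_zero]] at hc
  have hsum : ∑ j ∈ Finset.range ((e + 1) / 2), coeff j sincSeries *
      coeff (n - j) (1 - 2 * depthOneSeries 1) * coeff e (t * r ^ (2 * j + 1)) =
      -2 * ∑ j ∈ Finset.range ((e + 1) / 2), coeff j sincSeries * zetaValue (2 * n - 2 * j) *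
        coeff e (t * r ^ (2 * j + 1)) := by
    rw [Finset.mul_sum]
    refine Finset.sum_congr rfl fun j hj => ?_
    rw [Finset.mem_range] at hj
    rw [hdepth _ _ (by lia), zetaValue, Nat.mul_sub]
    ring
  rw [hsum] at hc
  rw [restrictedSeries, coeff_mk, coeff_mk] at hc
  rw [altZetaValue]
  linear_combination hc / 2

/-- The first part says that the defining limits of all Euler sums with positive even arguments
(hence of all values in the formula) exist. In the second part `j < d / 2` says that
`0 ≤ j ≤ ⌊(d - 2) / 2⌋`. -/
theorem mainTheorem4 :
    (∀ (d : ℕ) (j : Fin d → ℕ) (ε : Fin d → ℤˣ), (∀ i, 0 < j i) →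
      Tendsto (eulerPartialSum (fun i => 2 * j i) ε) atTop (𝓝 (eulerSum (fun i => 2 * j i) ε))) ∧
    ∀ n d : ℕ, 1 ≤ d → d ≤ n →
      restrictedSum 1 n d =
        altZetaValue (2 * n) -
          ∑ j ∈ Finset.range (d / 2), ∑ k ∈ Finset.range (2 * j + 2),
            (-1 : ℝ) ^ (d + j + k) / (Nat.factorial (2 * j + 1) : ℝ) *
              (Nat.choose (2 * j + 1) k : ℝ) * Ring.choose (((k : ℝ) - 3) / 2) (d - 1) *
              zetaValue (2 * n - 2 * j) * Real.pi ^ (2 * j) := by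
  refine ⟨fun d j ε hj => tendsto_eulerPartialSum _ ε fun i => by have := hj i; lia, ?_⟩
  intro n d hd hdn
  obtain ⟨e, rfl⟩ := Nat.exists_eq_add_of_le' hd
  rw [restrictedSum_one_succ hdn, eq_sub_iff_add_eq, add_assoc, add_eq_left,
    ← Finset.sum_add_distrib]
  refine Finset.sum_eq_zero fun j _ => ?_
  rw [coeff_oneSubPow_mul_pow, Finset.mul_sum, ← Finset.sum_add_distrib]
  refine Finset.sum_eq_zero fun k _ => ?_
  rw [sincSeries, coeff_mk, Nat.add_sub_cancel]
  ring
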